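/- Fix a field $\mathbb F$ of characteristic different from $2$. Let $\Omega$ be a finite nonempty set. A *rainbow* on $\Omega$ is a partition $C$ of $\Omega\times\Omega$ into nonempty relations (called basic) such that the diagonal $1_\Omega$ is a union of members of $C$ and $C$ is closed under transposition $s\mapsto s^t$. It is a *Jordan scheme* if moreover $1_\Omega\in C$ and the $\mathbb F$-span of the $0/1$ adjacency matrices of the members of $C$ is closed under $A\star B=\tfrac12(AB+BA)$. For a relation $s$ on $\Omega$ write $s\omega=\{\beta\in\Omega : (\omega,\beta)\in s\}$. A Jordan scheme is *thin* if $|s\omega|\le 1$ and $|s^t\omega|\le 1$ for all $s\in C$, $\omega\in\Omega$, and *regular* if, for each $s\in C$, $|s\omega|$ does not depend on $\omega$; in a regular thin Jordan scheme each $s\in C$ is a permutation $\omega\mapsto s(\omega)$ of $\Omega$. An isomorphism $(\Omega,C)\to(\Omega',C')$ is a bijection $f:\Omega\to\Omega'$ with $\{f(s):s\in C\}=C'$, where $f(s)=\{(f(\alpha),f(\beta)):(\alpha,\beta)\in s\}$. A *loop* is a magma with a two-sided neutral element in which $a\diamond x=b$ and $x\diamond a=b$ are uniquely solvable for $x$.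 It is an *RA (ring-alternative) loop* if for every commutative ring $R$ its loop ring over $R$ is alternative, i.e. satisfies $(xx)y=x(xy)$ and $(yx)x=y(xx)$ (so groups are RA loops). For a loop $(S,\diamond)$ put $\ell_a:x\mapsto a\diamond x$, viewed as the relation $\{(x,a\diamond x):x\in S\}$. **Theorem.** 1. For a finite loop $(S,\diamond)$, the set $\{\ell_a : a\in S\}$ is a thin Jordan scheme on $S$ if and only if $(S,\diamond)$ is an RA loop. 2. Let $(\Omega,C)$ be a regular thin Jordan scheme and $\omega_0\in\Omega$. For $a,b\in C$ let $a\diamond b$ be the unique member of $C$ containing $(\omega_0,a(b(\omega_0)))$. Then $(C,\diamond)$ is an RA loop, and $\sigma:C\to\Omega$, $\sigma(s)=s(\omega_0)$, is an isomorphism from $(C,\{\ell_a\}_{a\in C})$ to $(\Omega,C)$ with $\sigma(\ell_a)=a$ for all $a\in C$. 3. If $(S,\diamond)$ is a finite RA loop with neutral element $e$, then $(S,\{\ell_a\}_{a\in S})$ is a regular thin Jordan scheme, and $a\mapsto \ell_a$ is an isomorphism from $(S,\diamond)$ onto the loop constructed in part 2 from this scheme with base point $\omega_0=e$. 4. Two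 finite RA loops are isomorphic if and only if their schemes $\{\ell_a\}$ are isomorphic. Consequently $(S,\diamond)\mapsto(S,\{\ell_a\}_{a\in S})$ induces a one-to-one correspondence between isomorphism classes of finite RA loops and isomorphism classes of regular thin Jordan schemes, the inverse being given by the construction in part 2. -/

import Mathlib

open scoped MonoidAlgebra

universe u v w

section Rainbows

variable {Ω : Type u}

/-- The neighbourhood `sω = {β | (ω, β) ∈ s}` of a point `ω` under a binary relation `s`. -/
def relNbhd (s : SetRel Ω Ω) (ω : Ω) : Set Ω := {β | (ω, β) ∈ s}

/-- A relation is regular if the cardinality of `sω` does not depend on `ω`. -/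
def IsRegularRel (s : SetRel Ω Ω) : Prop :=
  ∀ ω ω' : Ω, (relNbhd s ω).ncard = (relNbhd s ω').ncard

/-- A relation is thin if `|sω| ≤ 1` and `|sᵗω| ≤ 1` for every point `ω`. -/
def IsThinRel (s : SetRel Ω Ω) : Prop :=
  ∀ ω : Ω, (relNbhd s ω).ncard ≤ 1 ∧ (relNbhd s.inv ω).ncard ≤ 1

/-- A rainbow on the nonempty set `Ω` is a partition `C` of `Ω × Ω` such that the diagonal is a
union of members of `C`, and `C` is closed under transposition. -/
structure IsRainbow (C : Set (SetRel Ω Ω)) : Prop where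
  nonempty : Nonempty Ω
  isPartition : Setoid.IsPartition C
  diagonal : ∃ D ⊆ C, ⋃₀ D = (SetRel.id : SetRel Ω Ω)
  transpose : SetRel.inv '' C = C

open Classical in
/-- The adjacency matrix (with entries `0` and `1`) of a binary relation. -/
noncomputable def adjacencyMatrix (F : Type w) [Field F] (s : SetRel Ω Ω) : Matrix Ω Ω F :=
  Matrix.of fun α β => if (α, β) ∈ s then 1 else 0

/-- The linear span of the adjacency matrices of the members of `C`. -/
noncomputable def adjacencyAlgebra (F : Type w) [Field F] (C : Set (SetRel Ω Ω)) :
    Submodule F (Matrix Ω Ω F) :=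
  Submodule.span F (adjacencyMatrix F '' C)

/-- A coherent J-configuration: a rainbow whose adjacency algebra is closed under the Jordan
product `(AB + BA) / 2`. -/
structure IsJConfiguration (F : Type w) [Field F] [Fintype Ω] (C : Set (SetRel Ω Ω)) : Prop where
  isRainbow : IsRainbow C
  jordan_mem : ∀ A ∈ adjacencyAlgebra F C, ∀ B ∈ adjacencyAlgebra F C,
    (2⁻¹ : F) • (A * B + B * A) ∈ adjacencyAlgebra F C

/-- A Jordan scheme: a homogeneous coherent J-configuration, that is, one in which the diagonal
relation is a basic relation. -/
structure IsJordanScheme (F : Type w) [Field F] [Fintype Ω] (C : Set (SetRel Ω Ω)) : Prop where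
  isJConfiguration : IsJConfiguration F C
  homogeneous : (SetRel.id : SetRel Ω Ω) ∈ C

/-- A thin Jordan scheme: all basic relations are thin. -/
structure IsThinJordanScheme (F : Type w) [Field F] [Fintype Ω] (C : Set (SetRel Ω Ω)) :
    Prop where
  isJordanScheme : IsJordanScheme F C
  thin : ∀ s ∈ C, IsThinRel s

/-- A regular thin Jordan scheme: all basic relations are thin and regular. -/
structure IsRegularThinJordanScheme (F : Type w) [Field F] [Fintype Ω]
    (C : Set (SetRel Ω Ω)) : Prop where
  isThinJordanScheme : IsThinJordanScheme F C
  regular : ∀ s ∈ C, IsRegularRel s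

/-- The image `f(s) = {(f α, f β) | (α, β) ∈ s}` of a relation under a map of point sets. -/
def mapRel {Ω' : Type v} (f : Ω → Ω') (s : SetRel Ω Ω) : SetRel Ω' Ω' := Prod.map f f '' s

/-- `f` is a (combinatorial) isomorphism from the rainbow `(Ω, C)` to the rainbow `(Ω', C')`. -/
def IsRainbowIso {Ω' : Type v} (f : Ω → Ω') (C : Set (SetRel Ω Ω)) (C' : Set (SetRel Ω' Ω')) :
    Prop :=
  Function.Bijective f ∧ mapRel f '' C = C'

end Rainbows

section Loops

/-- A loop: a magma with a two-sided neutral element in which all equations `a * x = b` and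
`x * a = b` are uniquely solvable for `x`. -/
structure IsLoop (S : Type u) [Mul S] : Prop where
  exists_one : ∃ e : S, ∀ x : S, e * x = x ∧ x * e = x
  left_div : ∀ a b : S, ∃! x : S, a * x = b
  right_div : ∀ a b : S, ∃! x : S, x * a = b

/-- A (not necessarily associative) ring is alternative if it satisfies the left and right
alternative laws. -/
def IsAlternativeRing (A : Type u) [NonUnitalNonAssocRing A] : Prop :=
  ∀ x y : A, (x * x) * y = x * (x * y) ∧ (y * x) * x = y * (x * x)

/-- A ring-alternative loop: a loop `S` such that the loop ring `R[S]` is alternative for every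
commutative ring `R`. -/
def IsRALoop (S : Type u) [Mul S] : Prop :=
  IsLoop S ∧ ∀ (R : Type v) [CommRing R], IsAlternativeRing R[S]

/-- The left multiplication `ℓ_a : x ↦ a * x`, regarded as a binary relation. -/
def leftMulRel {S : Type u} [Mul S] (a : S) : SetRel S S := {p | p.2 = a * p.1}

/-- The set of all left multiplications of `S`. -/
def leftMulRels (S : Type u) [Mul S] : Set (SetRel S S) := Set.range leftMulRel

end Loops

section BasedLoop

variable {Ω : Type u} {F : Type w} [Field F] [Fintype Ω] {C : Set (SetRel Ω Ω)}

/-- The unique basic relation `C(α, β)` containing the pair `(α, β)`. -/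
noncomputable def IsRainbow.basic (hC : IsRainbow C) (α β : Ω) : C :=
  ⟨(hC.isPartition.2 (α, β)).choose, (hC.isPartition.2 (α, β)).choose_spec.1.1⟩

/-- In a regular thin Jordan scheme every basic relation is a function. -/
theorem IsRegularThinJordanScheme.existsUnique (hC : IsRegularThinJordanScheme F C) (s : C)
    (ω : Ω) : ∃! β, (ω, β) ∈ (s : SetRel Ω Ω) := by
  obtain ⟨s, hs⟩ := s
  have hpart := hC.isThinJordanScheme.isJordanScheme.isJConfiguration.isRainbow.isPartition
  obtain ⟨⟨α, β⟩, hαβ⟩ := Setoid.nonempty_of_mem_partition hpart hs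
  have h1 : (relNbhd s ω).ncard = 1 := by
    have hpos : 0 < (relNbhd s α).ncard := (Set.ncard_pos (Set.toFinite _)).2 ⟨β, hαβ⟩
    have hle := (hC.isThinJordanScheme.thin s hs ω).1
    have heq := hC.regular s hs α ω
    omega
  obtain ⟨γ, hγ⟩ := Set.ncard_eq_one.1 h1
  have key : ∀ δ, (ω, δ) ∈ s ↔ δ = γ := fun δ => by
    change δ ∈ relNbhd s ω ↔ _
    rw [hγ, Set.mem_singleton_iff]
  exact ⟨γ, (key γ).2 rfl, fun δ hδ => (key δ).1 hδ⟩

/-- The value `s(ω)` of a basic relation `s`, the unique point with `(ω, s(ω)) ∈ s`. -/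
noncomputable def IsRegularThinJordanScheme.val (hC : IsRegularThinJordanScheme F C) (s : C)
    (ω : Ω) : Ω :=
  (hC.existsUnique s ω).choose

/-- The set of basic relations of a regular thin Jordan scheme `(Ω, C)`, as the carrier of the
operation determined by a base point `ω₀`. -/
def BasedLoop (_hC : IsRegularThinJordanScheme F C) (_ω₀ : Ω) : Type u := C

/-- The operation `a ⋄ b = C(ω₀, a(b(ω₀)))`. -/
noncomputable instance (hC : IsRegularThinJordanScheme F C) (ω₀ : Ω) : Mul (BasedLoop hC ω₀) where
  mul a b := hC.isThinJordanScheme.isJordanScheme.isJConfiguration.isRainbow.basic ω₀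
    (hC.val a (hC.val b ω₀))

/-- The basic relation underlying an element of `BasedLoop hC ω₀`. -/
def BasedLoop.rel {hC : IsRegularThinJordanScheme F C} {ω₀ : Ω} (s : BasedLoop hC ω₀) :
    SetRel Ω Ω :=
  Subtype.val (p := (· ∈ C)) s

/-- The map `σ : s ↦ s(ω₀)` from the basic relations to the points. -/
noncomputable def BasedLoop.toPoint {hC : IsRegularThinJordanScheme F C} {ω₀ : Ω}
    (s : BasedLoop hC ω₀) : Ω :=
  hC.val s ω₀

end BasedLoop

/-! Everything is reduced to two elementary conditions on a loop: `LeftJordan`, which says that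
{g(hk), h(gk)} and {(gh)k, (hg)k} agree as multisets, and the left inverse property.

For a scheme of left multiplications, closure under transposition gives the left inverse property.
Closure under ⋆ makes the entries of the symmetrized product of the matrices of `g` and `h` constant
on each basic relation; comparing the rows at `k` and at the neutral element gives `LeftJordan`,
because in characteristic different from 2 a sum of two indicators determines the multiset.
Conversely, the two conditions make the left multiplications a Jordan scheme.

The same conditions characterize RA loops (`isRALoop_iff`). They yield the right inverse property,
hence (ab)⁻¹ = b⁻¹a⁻¹, and inversion turns `LeftJordan` into `RightJordan`; linearization then gives
both alternative laws over every commutative ring. For a based scheme, `toPoint` carries left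
multiplication by `a` to `a` itself, so the same comparison of rows applies.

For loops with isomorphic schemes, an isomorphism `f` satisfies f(ax) = π(a)f(x), and `f` need not
fix the neutral element. With c = f(1) this reads π(ax)c = π(a)(π(x)c), so a pseudo-automorphism
with companion `c` corrects π to a loop isomorphism. One exists for every `c`: the identity if `c`
is nuclear, and conjugation by `c` otherwise, since then c² is central (`sq_commute`). -/

/-- The identity `ℓ_g ℓ_h + ℓ_h ℓ_g = ℓ_{gh} + ℓ_{hg}` for left multiplications, as an equality
of pairs of values at each point. -/
def LeftJordan (S : Type u) [Mul S] : Prop :=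
  ∀ g h k : S, (g * h * k = g * (h * k) ∧ h * g * k = h * (g * k)) ∨
    (g * h * k = h * (g * k) ∧ h * g * k = g * (h * k))

/-- The identity corresponding to `LeftJordan` for right multiplications. -/
def RightJordan (S : Type u) [Mul S] : Prop :=
  ∀ k g h : S, (k * g * h = k * (g * h) ∧ k * h * g = k * (h * g)) ∨
    (k * g * h = k * (h * g) ∧ k * h * g = k * (g * h))

/-- A loop with the left inverse property satisfying `LeftJordan`. -/
class JordanLoop (S : Type u) extends MulOneClass S, Inv S where
  inv_mul_cancel_left' : ∀ a x : S, a⁻¹ * (a * x) = x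
  mul_right_cancel' : ∀ {a b c : S}, a * c = b * c → a = b
  jordan : LeftJordan S

namespace JordanLoop

/-! ### Inverse properties, the right-hand identity and the Bol identity. -/

section Basic

variable {S : Type u} [JordanLoop S]

theorem left_cancel {a b c : S} (h : a * b = a * c) : b = c := by
  rw [← inv_mul_cancel_left' a b, h, inv_mul_cancel_left']

theorem inv_mul (a : S) : a⁻¹ * a = 1 := by
  simpa using inv_mul_cancel_left' a 1

theorem inv_inv' (a : S) : a⁻¹⁻¹ = a := by
  have h := inv_mul_cancel_left' a⁻¹ a
  rwa [inv_mul, mul_one] at h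

theorem mul_inv (a : S) : a * a⁻¹ = 1 := by
  have h := inv_mul a⁻¹
  rwa [inv_inv'] at h

theorem mul_inv_cancel_left' (a x : S) : a * (a⁻¹ * x) = x := by
  have h := inv_mul_cancel_left' a⁻¹ x
  rwa [inv_inv'] at h

theorem mul_assoc_of_commute {a b : S} (h : a * b = b * a) (k : S) : a * b * k = a * (b * k) := by
  rcases jordan a b k with h' | h'
  · exact h'.1
  · rw [h, h'.2]

theorem mul_left_comm_of_commute {a b : S} (h : a * b = b * a) (k : S) :
    a * (b * k) = b * (a * k) := by
  rw [← mul_assoc_of_commute h, h, mul_assoc_of_commute h.symm]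

theorem inv_commute {a b : S} (h : a * b = b * a) : a⁻¹ * b = b * a⁻¹ := by
  apply left_cancel (a := a)
  rw [mul_inv_cancel_left', mul_left_comm_of_commute h, mul_inv, mul_one]

theorem mul_inv_cancel_right' (g h : S) : g * h * h⁻¹ = g := by
  rcases jordan g h h⁻¹ with h' | h'
  · rw [h'.1, mul_inv, mul_one]
  -- In the crossed case `h * g` commutes with `h⁻¹`, hence with `h`, and this forces `g` and `h` to
  -- commute.
  · have e : h * g * h⁻¹ = g := by rw [h'.2, mul_inv, mul_one]
    have c1 : h⁻¹ * (h * g) = h * g * h⁻¹ := by rw [e, inv_mul_cancel_left']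
    have c2 : h * (h * g) = h * g * h := by
      have := inv_commute c1
      rwa [inv_inv'] at this
    have c3 : g * h = h * g := by
      have := mul_assoc_of_commute c1 h
      rw [inv_mul_cancel_left', ← c2, inv_mul_cancel_left'] at this
      exact this
    rw [c3, e]

theorem inv_mul_cancel_right' (g h : S) : g * h⁻¹ * h = g := by
  have := mul_inv_cancel_right' g h⁻¹
  rwa [inv_inv'] at this

theorem mul_inv_rev' (a b : S) : (a * b)⁻¹ = b⁻¹ * a⁻¹ := by
  apply left_cancel (a := b)
  rw [mul_inv_cancel_left']
  apply mul_right_cancel' (c := a * b)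
  rw [inv_mul_cancel_right', inv_mul_cancel_left']

theorem inv_inj' {a b : S} (h : a⁻¹ = b⁻¹) : a = b := by
  rw [← inv_inv' a, h, inv_inv']

/-- The right-hand version of the defining identity. -/
theorem jordan_right : RightJordan S := by
  intro k g h
  rcases jordan g⁻¹ h⁻¹ k⁻¹ with ⟨h1, h2⟩ | ⟨h1, h2⟩ <;>
    simp only [← mul_inv_rev'] at h1 h2 <;> replace h1 := inv_inj' h1 <;>
    replace h2 := inv_inj' h2
  · exact Or.inl ⟨h2.symm, h1.symm⟩
  · exact Or.inr ⟨h1.symm, h2.symm⟩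

/-- The additive form hides the choice between the two alternatives, so that several instances can
be combined linearly. -/
theorem jordan_sum (f : S → ℤ) (g h k : S) :
    f (g * h * k) + f (h * g * k) = f (g * (h * k)) + f (h * (g * k)) := by
  rcases jordan g h k with ⟨h1, h2⟩ | ⟨h1, h2⟩ <;> rw [h1, h2]
  rw [add_comm]

theorem mul_self_mul (a k : S) : a * a * k = a * (a * k) := mul_assoc_of_commute rfl k

theorem mul_mul_self (k a : S) : k * a * a = k * (a * a) := by
  rcases jordan_right k a a with h | h <;> exact h.1

/-- The left Bol identity. -/
theorem bol (x y z : S) : x * (y * x) * z = x * (y * (x * z)) := by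
  classical
  -- This is the counterpart of xyx = 2x∘(x∘y) − x²∘y for the Jordan product ∘: the six instances
  -- below combine to twice the desired equality of values of `f`, and ℤ has no 2-torsion.
  let f : S → ℤ := fun t => if t = x * (y * (x * z)) then 1 else 0
  have h1 := jordan_sum f x (y * x) z
  have h2 := jordan_sum f x y (x * z)
  have h3 := jordan_sum (fun t => f (x * t)) x y z
  have h4 := jordan_sum f x (x * y) z
  have h5 := jordan_sum f (x * x) y z
  have h6 := jordan_sum (fun t => f (t * z)) x y x
  simp only [mul_self_mul] at h1 h2 h3 h4 h5 h6
  have h7 : f (x * (y * x) * z) = f (x * (y * (x * z))) := by linarith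
  simp only [f, if_true] at h7
  by_contra hne
  simp [hne] at h7

theorem flexible (x y : S) : x * y * x = x * (y * x) := by
  rcases jordan x y x with h | ⟨h1, h2⟩
  · exact h.1
  · have := mul_mul_self y x
    rw [h2] at this
    rw [h1, this]

end Basic

/-! ### Associating triples, central squares and pseudo-automorphisms. -/

section Associating

variable {S : Type u} [JordanLoop S]

/-- The triple `(a, b, c)` associates. -/
def Assoc (a b c : S) : Prop := a * b * c = a * (b * c)

/-- If an associating triple falls under the crossed alternative, all four products coincide.
Together with `Assoc.swap_right`, this makes association independent of the order of the three
elements. -/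
theorem Assoc.swap_left {a b c : S} (h : Assoc a b c) : Assoc b a c := by
  rcases jordan a b c with h' | h'
  · exact h'.2
  · exact h'.2.trans (h.symm.trans h'.1)

theorem Assoc.swap_right {a b c : S} (h : Assoc a b c) : Assoc a c b := by
  rcases jordan_right a b c with h' | h'
  · exact h'.2
  · exact h'.2.trans (h.symm.trans h'.1)

theorem mul_mul_eq_of_not_assoc {a b c : S} (h : ¬ Assoc a b c) : a * b * c = b * (a * c) := by
  rcases jordan a b c with h' | h'
  · exact absurd h'.1 h
  · exact h'.1

theorem mul_mul_eq_of_not_assoc' {a b c : S} (h : ¬ Assoc a b c) : a * b * c = a * (c * b) := by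
  rcases jordan_right a b c with h' | h'
  · exact absurd h'.1 h
  · exact h'.1

theorem assoc_of_commute {a b : S} (h : a * b = b * a) (c : S) : Assoc a b c :=
  mul_assoc_of_commute h c

/-- Neither (g, gh, k) nor (hg, g, k) associates, and the crossed rules send both g(gh)·k and
(hg)g·k to g((hg)k); cancelling `k` leaves g(gh) = (hg)g. -/
theorem sq_commute_of_not_assoc {g h k : S} (n : ¬ Assoc g h k) : g * g * h = h * (g * g) := by
  have n' : ¬ Assoc h g k := fun a => n a.swap_left
  have hP : g * h * k = h * (g * k) := mul_mul_eq_of_not_assoc n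
  have hQ : h * g * k = g * (h * k) := mul_mul_eq_of_not_assoc n'
  have hQ' : k * (g * h) = h * g * k := by
    have n2 : ¬ Assoc k g h := fun a => n a.swap_left.swap_right
    have n3 : ¬ Assoc k h g := fun a => n a.swap_left.swap_right.swap_left
    have n4 : ¬ Assoc h k g := fun a => n3 a.swap_left
    rw [← mul_mul_eq_of_not_assoc' n3, mul_mul_eq_of_not_assoc n3, ← mul_mul_eq_of_not_assoc' n']
  have n1 : ¬ Assoc g (g * h) k := by
    intro a
    have a' : g * (g * h) * k = g * (g * h * k) := a
    rw [hP, ← bol] at a'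
    have := left_cancel (mul_right_cancel' a')
    exact n (assoc_of_commute this k)
  have n2 : ¬ Assoc (h * g) g k := by
    intro a
    have a' : g * (h * g) * k = g * (h * g * k) := a.swap_left
    rw [bol, hQ] at a'
    have := left_cancel a'
    exact n' (hQ.trans this.symm)
  have e1 : g * (g * h) * k = g * (h * g * k) := by
    rw [mul_mul_eq_of_not_assoc' n1, hQ']
  have e2 : h * g * g * k = g * (h * g * k) := mul_mul_eq_of_not_assoc n2
  have e3 := mul_right_cancel' (e1.trans e2.symm)
  rw [mul_self_mul, e3, mul_mul_self]

/-- A triple containing a commuting pair associates in every order, so `d` can be moved through the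
product. -/
theorem commute_of_commute_mul {d x z : S} (hx : d * x = x * d) (hzx : d * (z * x) = z * x * d) :
    d * z = z * d := by
  apply mul_right_cancel' (c := x)
  have h1 : Assoc d x z := assoc_of_commute hx z
  have h2 : d * z * x = d * (z * x) := h1.swap_right
  have h3 : z * d * x = z * (d * x) := h1.swap_right.swap_left
  have h4 : z * x * d = z * (x * d) := h1.swap_right.swap_left.swap_right
  rw [h2, h3, hzx, h4, hx]

theorem commute_of_commute_mul' {d x z : S} (hx : d * x = x * d)
    (hxz : d * (x * z) = x * z * d) : d * z = z * d := by
  apply left_cancel (a := x)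
  have h1 : Assoc d x z := assoc_of_commute hx z
  have h2 : x * d * z = x * (d * z) := h1.swap_left
  have h3 : x * z * d = x * (z * d) := h1.swap_left.swap_right
  rw [← h2, ← h3, ← hxz, ← hx]
  exact h1

/-- The square of an element outside the nucleus is central. -/
theorem sq_commute {c x y : S} (n : ¬ Assoc c x y) (z : S) : c * c * z = z * (c * c) := by
  by_contra hz
  have key : ∀ w, c * c * w ≠ w * (c * c) → ∀ k, Assoc c w k := fun w hw k => by
    by_contra hn
    exact hw (sq_commute_of_not_assoc hn)
  have hx := sq_commute_of_not_assoc n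
  have hy := sq_commute_of_not_assoc (fun a => n a.swap_right : ¬ Assoc c y x)
  -- Multiplying `z` by `x` or `y` on either side keeps it outside the centralizer of c², so `key`
  -- applies to these four products as well.
  have hzx : c * c * (z * x) ≠ z * x * (c * c) := fun h => hz (commute_of_commute_mul hx h)
  have hxz : c * c * (x * z) ≠ x * z * (c * c) := fun h => hz (commute_of_commute_mul' hx h)
  have hzy : c * c * (z * y) ≠ z * y * (c * c) := fun h => hz (commute_of_commute_mul hy h)
  have hyz : c * c * (y * z) ≠ y * z * (c * c) := fun h => hz (commute_of_commute_mul' hy h)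
  have e1 : c * x * z * y = c * (x * z * y) := by
    rw [show c * x * z = c * (x * z) from (key z hz x).swap_right, key _ hxz y]
  have e2 : c * x * (z * y) = c * (x * (z * y)) := (key _ hzy x).swap_right
  have e3 : z * c * x * y = z * (c * x) * y := by
    rw [show z * c * x = z * (c * x) from (key z hz x).swap_left]
  -- If (z, x, y) associates, then so does (c, x, y), contrary to `n`. If not, the crossed rules
  -- give cz = zc, so c² commutes with `z` after all.
  by_cases h : Assoc z x y
  · have h1 : Assoc (c * x) z y := by
      rw [Assoc, e1, e2, show x * z * y = x * (z * y) from h.swap_left]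
    have h2 : Assoc x y (z * c) := by
      rw [Assoc, ← show x * y * z * c = x * y * (z * c) from
          (key z hz (x * y)).swap_left.swap_right.swap_left,
        show x * y * z = x * (y * z) from h.swap_left.swap_right,
        show x * (y * z) * c = x * (y * z * c) from
          (key _ hyz x).swap_right.swap_left.swap_right,
        show y * z * c = y * (z * c) from (key z hz y).swap_right.swap_left.swap_right]
    have h3 : z * c * x * y = z * c * (x * y) := h2.swap_right.swap_left
    have h4 : z * (c * x) * y = z * (c * x * y) := h1.swap_left
    have h5 : z * c * (x * y) = z * (c * (x * y)) := (key z hz (x * y)).swap_left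
    exact n (left_cancel (h4.symm.trans (e3.symm.trans (h3.trans h5))))
  · have h1 : ¬ Assoc z (c * x) y := by
      intro h1
      have h2 : c * x * z * y = c * x * (z * y) := h1.swap_left
      rw [e1, e2] at h2
      exact h (Assoc.swap_left (left_cancel h2))
    have h2 : c * z * x * y = z * c * x * y := by
      rw [show c * z * x = c * (z * x) from key z hz x,
        show c * (z * x) * y = c * (z * x * y) from key _ hzx y,
        mul_mul_eq_of_not_assoc h, ← e2, e3, mul_mul_eq_of_not_assoc h1]
    have h3 : c * z = z * c := mul_right_cancel' (mul_right_cancel' h2)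
    apply hz
    rw [mul_self_mul, h3, ← mul_mul_self, ← h3, flexible, h3]

/-- For each `c` there is a bijection `φ` which is a pseudo-automorphism with companion `c`. -/
theorem exists_pseudoautomorphism (c : S) :
    ∃ φ : S ≃ S, ∀ x y, φ x * (φ y * c) = φ (x * y) * c := by
  by_cases hc : ∀ x y, Assoc c x y
  · exact ⟨Equiv.refl S, fun x y => ((hc x y).swap_left.swap_right).symm⟩
  push Not at hc
  obtain ⟨u, v, n⟩ := hc
  have hq := sq_commute n
  -- As c² is central, φ(y)c = c²(c⁻¹y) = cy and φ(x) = c²(c⁻¹xc⁻¹). The Bol identity for c⁻¹, x and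
  -- cy then gives the claim.
  refine ⟨⟨fun y => c⁻¹ * y * c, fun y => c * (y * c⁻¹), fun y => ?_, fun y => ?_⟩,
    fun x y => ?_⟩
  · simp only [mul_inv_cancel_right', mul_inv_cancel_left']
  · simp only [inv_mul_cancel_left', inv_mul_cancel_right']
  · have a1 : ∀ a b, c * c * a * b = c * c * (a * b) := fun a b => assoc_of_commute (hq a) b
    have a2 : ∀ a b, a * (c * c * b) = c * c * (a * b) := fun a b => by
      rw [← show a * (c * c) * b = a * (c * c * b) from Assoc.swap_left (a1 a b), ← hq, a1]
    have a3 : ∀ a, a * c = c * c * (a * c⁻¹) := fun a => by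
      rw [← a2, mul_self_mul, mul_inv, mul_one]
    have a4 : c * c * (c⁻¹ * y) = c * y := by rw [mul_self_mul, mul_inv_cancel_left']
    simp only [Equiv.coe_fn_mk]
    rw [mul_mul_self, ← hq, a4, a3 (c⁻¹ * x), a1, flexible, bol, inv_mul_cancel_left',
      mul_mul_self, ← hq]

end Associating

/-! ### From conjugate left multiplications to a loop isomorphism. -/

/-- Two loops whose sets of left multiplications are conjugate are isomorphic. -/
theorem nonempty_mulEquiv {S : Type u} {T : Type v} [MulOneClass S] [JordanLoop T]
    {f : S → T} (hf : Function.Bijective f) {π : S → T} (h : ∀ a x, f (a * x) = π a * f x) :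
    Nonempty (S ≃* T) := by
  obtain ⟨φ, hφ⟩ := exists_pseudoautomorphism (f 1)
  have h1 : ∀ a, f a = π a * f 1 := fun a => by rw [← h, mul_one]
  have hmul : ∀ a x, π (a * x) * f 1 = π a * (π x * f 1) := fun a x => by rw [← h1, ← h1, h]
  have hπ : Function.Bijective π := by
    refine ⟨fun a b hab => hf.1 (by rw [h1, hab, ← h1]), fun t => ?_⟩
    obtain ⟨a, ha⟩ := hf.2 (t * f 1)
    exact ⟨a, mul_right_cancel' ((h1 a).symm.trans ha)⟩
  -- By `hmul`, π distorts products by the companion `f 1` exactly as φ does, so φ⁻¹ ∘ π is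
  -- multiplicative.
  refine ⟨MulEquiv.mk ((Equiv.ofBijective π hπ).trans φ.symm) fun a x => ?_⟩
  simp only [Equiv.trans_apply, Equiv.ofBijective_apply, Equiv.toFun_as_coe]
  rw [Equiv.symm_apply_eq]
  apply mul_right_cancel' (c := f 1)
  rw [← hφ, hmul, Equiv.apply_symm_apply, Equiv.apply_symm_apply]

end JordanLoop

section Indicators

open Classical in
-- The sums count multiplicities 0, 1, 2, which remain distinct in `R` because 2 ≠ 0.
theorem pair_eq_pair_of_indicator {α : Type*} {R : Type*} [Ring R] (h2 : (2 : R) ≠ 0)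
    {p q r s : α}
    (h : ∀ t, ((if p = t then 1 else 0) + (if q = t then 1 else 0) : R) =
      (if r = t then 1 else 0) + (if s = t then 1 else 0)) :
    (p = r ∧ q = s) ∨ (p = s ∧ q = r) := by
  have h1 : (1 : R) ≠ 0 := fun h1 => h2 (by rw [← one_add_one_eq_two, h1, add_zero])
  have h21 : (2 : R) ≠ 1 := fun h3 => h1 (by rw [← one_add_one_eq_two] at h3; simpa using h3)
  have hp := h p
  have hq := h q
  have hr := h r
  have hs := h s
  by_cases e1 : p = r <;> by_cases e2 : q = s <;> by_cases e3 : p = s <;> by_cases e4 : q = r <;>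
    by_cases e5 : p = q <;> by_cases e6 : r = s <;> subst_vars <;>
    simp_all [one_add_one_eq_two, eq_comm]

end Indicators

/-! ### Alternative laws in loop rings. -/

section LoopRings

open MonoidAlgebra

variable {S : Type u} [Mul S] {R : Type v} [CommRing R]

theorem LeftJordan.mul_self_mul (hJ : LeftJordan S) (g k : S) : g * g * k = g * (g * k) := by
  rcases hJ g g k with h | h <;> exact h.1

theorem RightJordan.mul_mul_self (hJ : RightJordan S) (k g : S) : k * g * g = k * (g * g) := by
  rcases hJ k g g with h | h <;> exact h.1

theorem LeftJordan.linearized (hJ : LeftJordan S) (x x' y : R[S]) :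
    x * x' * y + x' * x * y = x * (x' * y) + x' * (x * y) := by
  induction x using MonoidAlgebra.induction_linear with
  | zero => simp
  | add a b ha hb =>
    convert congrArg₂ (· + ·) ha hb using 1 <;> simp only [add_mul, mul_add] <;> abel
  | single g r =>
    induction x' using MonoidAlgebra.induction_linear with
    | zero => simp
    | add a b ha hb =>
      convert congrArg₂ (· + ·) ha hb using 1 <;> simp only [add_mul, mul_add] <;> abel
    | single h s =>
      induction y using MonoidAlgebra.induction_linear with
      | zero => simp
      | add a b ha hb =>
        convert congrArg₂ (· + ·) ha hb using 1 <;> simp only [mul_add] <;> abel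
      | single k t =>
        simp only [single_mul_single, mul_assoc, mul_left_comm s r t]
        rcases hJ g h k with ⟨h1, h2⟩ | ⟨h1, h2⟩ <;> rw [h1, h2]
        exact add_comm _ _

theorem RightJordan.linearized (hJ : RightJordan S) (x x' y : R[S]) :
    y * x * x' + y * x' * x = y * (x * x') + y * (x' * x) := by
  induction x using MonoidAlgebra.induction_linear with
  | zero => simp
  | add a b ha hb =>
    convert congrArg₂ (· + ·) ha hb using 1 <;> simp only [add_mul, mul_add] <;> abel
  | single g r =>
    induction x' using MonoidAlgebra.induction_linear with
    | zero => simp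
    | add a b ha hb =>
      convert congrArg₂ (· + ·) ha hb using 1 <;> simp only [add_mul, mul_add] <;> abel
    | single h s =>
      induction y using MonoidAlgebra.induction_linear with
      | zero => simp
      | add a b ha hb =>
        convert congrArg₂ (· + ·) ha hb using 1 <;> simp only [add_mul] <;> abel
      | single k t =>
        simp only [single_mul_single, mul_assoc, mul_comm s r]
        rcases hJ k g h with ⟨h1, h2⟩ | ⟨h1, h2⟩ <;> rw [h1, h2]
        exact add_comm _ _

/-- The law is quadratic in `x`: the diagonal terms come from basis elements and the cross terms
from `LeftJordan.linearized`. -/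
theorem LeftJordan.left_alternative (hJ : LeftJordan S) (x y : R[S]) :
    x * x * y = x * (x * y) := by
  induction x using MonoidAlgebra.induction_linear with
  | zero => simp
  | add a b ha hb =>
    convert congrArg₂ (· + ·) (congrArg₂ (· + ·) ha hb) (hJ.linearized a b y) using 1 <;>
      simp only [add_mul, mul_add] <;> abel
  | single g r =>
    induction y using MonoidAlgebra.induction_linear with
    | zero => simp
    | add a b ha hb => simp only [mul_add, ha, hb]
    | single k t => simp only [single_mul_single, mul_assoc, hJ.mul_self_mul]

theorem RightJordan.right_alternative (hJ : RightJordan S) (x y : R[S]) :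
    y * x * x = y * (x * x) := by
  induction x using MonoidAlgebra.induction_linear with
  | zero => simp
  | add a b ha hb =>
    convert congrArg₂ (· + ·) (congrArg₂ (· + ·) ha hb) (hJ.linearized a b y) using 1 <;>
      simp only [add_mul, mul_add] <;> abel
  | single g r =>
    induction y using MonoidAlgebra.induction_linear with
    | zero => simp
    | add a b ha hb => simp only [add_mul, ha, hb]
    | single k t => simp only [single_mul_single, mul_assoc, hJ.mul_mul_self]

theorem isAlternativeRing_of_leftJordan_of_rightJordan (hl : LeftJordan S) (hr : RightJordan S) :
    IsAlternativeRing R[S] :=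
  fun x y => ⟨hl.left_alternative x y, hr.right_alternative x y⟩

theorem mul_mul_self_of_isAlternativeRing [Nontrivial R] (hA : IsAlternativeRing R[S])
    (k g : S) : k * g * g = k * (g * g) := by
  have h := (hA (single g (1 : R)) (single k 1)).2
  simp only [single_mul_single, mul_one] at h
  exact Finsupp.single_left_injective (one_ne_zero (α := R)) (congrArg coeff h)

theorem leftJordan_of_isAlternativeRing (h2 : (2 : R) ≠ 0) (hA : IsAlternativeRing R[S]) :
    LeftJordan S := by
  classical
  intro g h k
  have e1 := (hA (single g (1 : R) + single h 1) (single k 1)).1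
  have e2 := (hA (single g (1 : R)) (single k 1)).1
  have e3 := (hA (single h (1 : R)) (single k 1)).1
  simp only [add_mul, mul_add, single_mul_single, mul_one] at e1 e2 e3
  rw [e2, e3] at e1
  refine pair_eq_pair_of_indicator h2 fun t => ?_
  have e4 := congrArg (fun x : R[S] => x.coeff t) e1
  simp only [coeff_add, coeff_single, Finsupp.add_apply, Finsupp.single_apply] at e4
  convert_to _ = ((if g * (h * k) = t then 1 else 0) + (if h * (g * k) = t then 1 else 0) : R)
  linear_combination e4

end LoopRings

/-! ### Elementary characterization of RA loops. -/

section RALoops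

variable {S : Type u} [Mul S]

/-- A loop with the left inverse property satisfying `LeftJordan` is a `JordanLoop`. -/
theorem exists_jordanLoop (hS : IsLoop S) (hJ : LeftJordan S)
    (hinv : ∀ a : S, ∃ b, ∀ x, b * (a * x) = x) :
    ∃ J : JordanLoop S, J.toMulOneClass.toMul = ‹Mul S› := by
  obtain ⟨e, he⟩ := hS.exists_one
  choose i hi using hinv
  exact ⟨{ ‹Mul S› with
    one := e
    one_mul := fun x => (he x).1
    mul_one := fun x => (he x).2
    inv := i
    inv_mul_cancel_left' := hi
    mul_right_cancel' := fun {a b c} h => (hS.right_div c (b * c)).unique h rfl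
    jordan := hJ }, rfl⟩

theorem exists_left_inv_of_alternative (hS : IsLoop S) (hJ : LeftJordan S)
    (hr : ∀ k g : S, k * g * g = k * (g * g)) (a : S) : ∃ b, ∀ x, b * (a * x) = x := by
  obtain ⟨e, he⟩ := hS.exists_one
  obtain ⟨b, hb, -⟩ := hS.left_div a e
  -- The right inverse `b` of `a` is shown to be a left inverse too; both alternatives for (a, b, x)
  -- then give b(ax) = x.
  have h1 : a * (b * a) = a := by
    rcases hJ a b a with ⟨h, -⟩ | ⟨h, h'⟩
    · rw [← h, hb, (he a).1]
    · rw [← h', hr, ← h, hb, (he a).1]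
  have h2 : b * a = e := (hS.left_div a a).unique h1 (he a).2
  refine ⟨b, fun x => ?_⟩
  rcases hJ a b x with ⟨-, h⟩ | ⟨h, -⟩
  · rw [← h, h2, (he x).1]
  · rw [← h, hb, (he x).1]

theorem isRALoop_iff (hS : IsLoop S) :
    IsRALoop.{u, v} S ↔ LeftJordan S ∧ ∀ a : S, ∃ b, ∀ x, b * (a * x) = x := by
  constructor
  · intro h
    -- One test ring with 2 ≠ 0 suffices; ℤ is lifted to the required universe.
    have h2 : (2 : ULift.{v} ℤ) ≠ 0 := fun h => absurd (congrArg ULift.down h) (by decide)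
    have hJ := leftJordan_of_isAlternativeRing h2 (h.2 (ULift.{v} ℤ))
    exact ⟨hJ, exists_left_inv_of_alternative hS hJ
      (mul_mul_self_of_isAlternativeRing (h.2 (ULift.{v} ℤ)))⟩
  · rintro ⟨hJ, hinv⟩
    refine ⟨hS, fun R _ => isAlternativeRing_of_leftJordan_of_rightJordan hJ ?_⟩
    obtain ⟨J, rfl⟩ := exists_jordanLoop hS hJ hinv
    exact JordanLoop.jordan_right

theorem IsRALoop.exists_jordanLoop (h : IsRALoop.{u, v} S) :
    ∃ J : JordanLoop S, J.toMulOneClass.toMul = ‹Mul S› :=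
  _root_.exists_jordanLoop h.1 ((isRALoop_iff h.1).1 h).1 ((isRALoop_iff h.1).1 h).2

end RALoops

/-! ### Adjacency matrices of graphs of functions. -/

section FunctionalRelations

variable {Ω : Type u}

/-- The graph of a function as a relation. -/
def graphRel (f : Ω → Ω) : SetRel Ω Ω := {p | p.2 = f p.1}

theorem mem_graphRel {f : Ω → Ω} {α β : Ω} : (α, β) ∈ graphRel f ↔ β = f α := Iff.rfl

open Classical in
theorem adjacencyMatrix_graphRel_mul (F : Type w) [Field F] [Fintype Ω] (f g : Ω → Ω) (α β : Ω) :
    (adjacencyMatrix F (graphRel f) * adjacencyMatrix F (graphRel g)) α β =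
      if g (f α) = β then 1 else 0 := by
  rw [Matrix.mul_apply, Finset.sum_eq_single (f α)]
  · simp [adjacencyMatrix, mem_graphRel, eq_comm]
  · intro j _ hj
    simp [adjacencyMatrix, mem_graphRel, hj]
  · simp

theorem apply_eq_of_mem_adjacencyAlgebra {F : Type w} [Field F] {C : Set (SetRel Ω Ω)}
    (hC : Setoid.IsPartition C) {M : Matrix Ω Ω F} (hM : M ∈ adjacencyAlgebra F C)
    {s : SetRel Ω Ω} (hs : s ∈ C) {α β α' β' : Ω} (h : (α, β) ∈ s) (h' : (α', β') ∈ s) :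
    M α β = M α' β' := by
  induction hM using Submodule.span_induction with
  | mem x hx =>
    obtain ⟨r, hr, rfl⟩ := hx
    have key : ∀ p q : Ω × Ω, p ∈ s → q ∈ s → p ∈ r → q ∈ r := fun p q hp hq hpr => by
      rwa [(hC.2 p).unique ⟨hr, hpr⟩ ⟨hs, hp⟩]
    have : (α, β) ∈ r ↔ (α', β') ∈ r := ⟨key _ _ h h', key _ _ h' h⟩
    by_cases h1 : (α, β) ∈ r
    · simp [adjacencyMatrix, h1, this.1 h1]
    · simp [adjacencyMatrix, h1, mt this.2 h1]
  | zero => rfl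
  | add x y _ _ hx hy => simp [hx, hy]
  | smul c x _ hx => simp [hx]

open Classical in
-- Both sides are entries, at two points of the graph of `c`, of the symmetrized product of the
-- matrices of `a` and `b`, and matrices in the span are constant on basic relations.
theorem IsJordanScheme.indicator_eq {F : Type w} [Field F] (hF : (2 : F) ≠ 0) [Fintype Ω]
    {C : Set (SetRel Ω Ω)} (hC : IsJordanScheme F C) {a b c : Ω → Ω} (ha : graphRel a ∈ C)
    (hb : graphRel b ∈ C) (hc : graphRel c ∈ C) (ω ω' : Ω) :
    ((if a (b ω) = c ω then 1 else 0) + (if b (a ω) = c ω then 1 else 0) : F) =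
      (if a (b ω') = c ω' then 1 else 0) + (if b (a ω') = c ω' then 1 else 0) := by
  have h := hC.isJConfiguration.jordan_mem _ (Submodule.subset_span (Set.mem_image_of_mem _ hb))
    _ (Submodule.subset_span (Set.mem_image_of_mem _ ha))
  have h' := apply_eq_of_mem_adjacencyAlgebra hC.isJConfiguration.isRainbow.isPartition h hc
    (mem_graphRel.2 (rfl : c ω = c ω)) (mem_graphRel.2 (rfl : c ω' = c ω'))
  simp only [Matrix.smul_apply, Matrix.add_apply, adjacencyMatrix_graphRel_mul, smul_eq_mul] at h'
  exact mul_left_cancel₀ (inv_ne_zero hF) h'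

theorem mapRel_graphRel {Ω' : Type v} {f : Ω → Ω'} (hf : Function.Bijective f) {a : Ω → Ω}
    {b : Ω' → Ω'} (h : ∀ x, f (a x) = b (f x)) : mapRel f (graphRel a) = graphRel b := by
  ext ⟨α, β⟩
  obtain ⟨α, rfl⟩ := hf.2 α
  obtain ⟨β, rfl⟩ := hf.2 β
  rw [mem_graphRel, ← h, hf.1.eq_iff]
  constructor
  · rintro ⟨⟨x, y⟩, hxy, he⟩
    obtain ⟨h1, h2⟩ := Prod.mk.inj he
    rwa [← hf.1 h1, ← hf.1 h2]
  · exact fun hβ => ⟨(α, β), hβ, rfl⟩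

end FunctionalRelations

/-! ### The scheme of left multiplications. -/

section LeftMultiplications

variable {S : Type u} [Mul S]

theorem leftMulRel_eq_graphRel (a : S) : leftMulRel a = graphRel (a * ·) := rfl

theorem mem_leftMulRel {a x y : S} : (x, y) ∈ leftMulRel a ↔ y = a * x := Iff.rfl

theorem IsLoop.leftMulRel_injective (hS : IsLoop S) :
    Function.Injective (leftMulRel : S → SetRel S S) := by
  obtain ⟨e, he⟩ := hS.exists_one
  intro a b h
  have : (e, a * e) ∈ leftMulRel b := h ▸ mem_leftMulRel.2 rfl
  rwa [mem_leftMulRel, (he a).2, (he b).2] at this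

theorem IsLoop.isPartition_leftMulRels (hS : IsLoop S) : Setoid.IsPartition (leftMulRels S) := by
  obtain ⟨e, he⟩ := hS.exists_one
  refine ⟨?_, ?_⟩
  · rintro ⟨a, ha⟩
    have : (e, a * e) ∈ leftMulRel a := mem_leftMulRel.2 rfl
    rw [ha] at this
    exact this
  · rintro ⟨x, y⟩
    obtain ⟨a, ha, ha'⟩ := hS.right_div x y
    refine ⟨leftMulRel a, ⟨⟨a, rfl⟩, mem_leftMulRel.2 ha.symm⟩, ?_⟩
    rintro _ ⟨⟨b, rfl⟩, hb⟩
    rw [ha' b (mem_leftMulRel.1 hb).symm]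

theorem inv_leftMulRel {a b : S} (h : ∀ x, b * (a * x) = x) (h' : ∀ x, a * (b * x) = x) :
    (leftMulRel a).inv = leftMulRel b := by
  ext ⟨x, y⟩
  change x = a * y ↔ y = b * x
  constructor
  · rintro rfl
    rw [h]
  · rintro rfl
    rw [h']

open Classical in
theorem adjacencyMatrix_leftMulRel_add (F : Type w) [Field F] [Fintype S] (hJ : LeftJordan S)
    (a b : S) :
    adjacencyMatrix F (leftMulRel a) * adjacencyMatrix F (leftMulRel b) +
        adjacencyMatrix F (leftMulRel b) * adjacencyMatrix F (leftMulRel a) =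
      adjacencyMatrix F (leftMulRel (a * b)) + adjacencyMatrix F (leftMulRel (b * a)) := by
  ext x y
  simp only [leftMulRel_eq_graphRel, Matrix.add_apply, adjacencyMatrix_graphRel_mul]
  simp only [adjacencyMatrix, Matrix.of_apply, mem_graphRel, eq_comm (a := y)]
  rcases hJ a b x with ⟨h1, h2⟩ | ⟨h1, h2⟩ <;> rw [h1, h2]
  exact add_comm _ _

theorem jordan_mem_adjacencyAlgebra_leftMulRels (F : Type w) [Field F] [Fintype S]
    (hJ : LeftJordan S) {A B : Matrix S S F} (hA : A ∈ adjacencyAlgebra F (leftMulRels S))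
    (hB : B ∈ adjacencyAlgebra F (leftMulRels S)) :
    A * B + B * A ∈ adjacencyAlgebra F (leftMulRels S) := by
  induction hA using Submodule.span_induction with
  | zero => simp
  | add x y _ _ hx hy =>
    convert add_mem hx hy using 1
    simp only [add_mul, mul_add]
    abel
  | smul c x _ hx =>
    convert Submodule.smul_mem _ c hx using 1
    simp
  | mem A hA =>
    induction hB using Submodule.span_induction with
    | zero => simp
    | add x y _ _ hx hy =>
      convert add_mem hx hy using 1
      simp only [add_mul, mul_add]
      abel
    | smul c x _ hx =>
      convert Submodule.smul_mem _ c hx using 1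
      simp
    | mem B hB =>
      obtain ⟨_, ⟨a, rfl⟩, rfl⟩ := hA
      obtain ⟨_, ⟨b, rfl⟩, rfl⟩ := hB
      rw [adjacencyMatrix_leftMulRel_add F hJ]
      exact add_mem (Submodule.subset_span ⟨_, ⟨_, rfl⟩, rfl⟩)
        (Submodule.subset_span ⟨_, ⟨_, rfl⟩, rfl⟩)

theorem JordanLoop.isRainbow_leftMulRels {S : Type u} [JordanLoop S] (hS : IsLoop S) :
    IsRainbow (leftMulRels S) where
  nonempty := ⟨1⟩
  isPartition := hS.isPartition_leftMulRels
  diagonal := ⟨{leftMulRel 1}, by rintro _ rfl; exact ⟨1, rfl⟩, by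
    ext ⟨x, y⟩
    rw [Set.sUnion_singleton, mem_leftMulRel, one_mul]
    exact eq_comm⟩
  transpose := by
    have h : ∀ a : S, (leftMulRel a).inv = leftMulRel a⁻¹ := fun a =>
      inv_leftMulRel (inv_mul_cancel_left' a) (mul_inv_cancel_left' a)
    ext s
    constructor
    · rintro ⟨_, ⟨a, rfl⟩, rfl⟩
      exact ⟨a⁻¹, (h a).symm⟩
    · rintro ⟨a, rfl⟩
      exact ⟨_, ⟨a⁻¹, rfl⟩, by rw [h, inv_inv']⟩

theorem relNbhd_leftMulRel (a x : S) : relNbhd (leftMulRel a) x = {a * x} := rfl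

theorem JordanLoop.isRegularThinJordanScheme_leftMulRels (F : Type w) [Field F] {S : Type u}
    [Fintype S] [JordanLoop S] (hS : IsLoop S) :
    IsRegularThinJordanScheme F (leftMulRels S) where
  isThinJordanScheme :=
    { isJordanScheme :=
        { isJConfiguration :=
            { isRainbow := isRainbow_leftMulRels hS
              jordan_mem := fun _ hA _ hB => Submodule.smul_mem _ _
                (jordan_mem_adjacencyAlgebra_leftMulRels F jordan hA hB) }
          homogeneous := ⟨1, by
            ext ⟨x, y⟩
            rw [mem_leftMulRel, one_mul]
            exact eq_comm⟩ }
      thin := by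
        rintro _ ⟨a, rfl⟩ x
        rw [inv_leftMulRel (inv_mul_cancel_left' a) (mul_inv_cancel_left' a)]
        simp only [relNbhd_leftMulRel, Set.ncard_singleton, le_refl, and_self] }
  regular := by
    rintro _ ⟨a, rfl⟩ x y
    simp only [relNbhd_leftMulRel, Set.ncard_singleton]

theorem IsRALoop.isRegularThinJordanScheme (F : Type w) [Field F] [Fintype S]
    (h : IsRALoop.{u, v} S) : IsRegularThinJordanScheme F (leftMulRels S) := by
  have hS := h.1
  obtain ⟨J, rfl⟩ := h.exists_jordanLoop
  exact JordanLoop.isRegularThinJordanScheme_leftMulRels F hS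

theorem IsThinJordanScheme.isRALoop {F : Type w} [Field F] (hF : (2 : F) ≠ 0) [Fintype S]
    (hS : IsLoop S) (hC : IsThinJordanScheme F (leftMulRels S)) : IsRALoop.{u, v} S := by
  classical
  obtain ⟨e, he⟩ := hS.exists_one
  refine (isRALoop_iff hS).2 ⟨fun g h k => ?_, fun a => ?_⟩
  · refine (pair_eq_pair_of_indicator hF (p := g * (h * k)) (q := h * (g * k)) (r := g * h * k)
      (s := h * g * k) (fun t => ?_)).imp (And.imp Eq.symm Eq.symm)
      (fun h' => ⟨h'.2.symm, h'.1.symm⟩)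
    -- The rows at `k` and `e` are compared on the relation of `c`: the first tests g(hk) and h(gk)
    -- against ck, the second tests gh and hg against c.
    obtain ⟨c, rfl, -⟩ := hS.right_div k t
    have := hC.isJordanScheme.indicator_eq hF (a := (g * ·)) (b := (h * ·)) (c := (c * ·))
      ⟨g, rfl⟩ ⟨h, rfl⟩ ⟨c, rfl⟩ k e
    have hk : ∀ x : S, x * k = c * k ↔ x = c := fun x =>
      ⟨fun hx => (hS.right_div k (c * k)).unique hx rfl, fun hx => by rw [hx]⟩
    simpa only [(he _).2, hk] using this
  · have : (leftMulRel a).inv ∈ leftMulRels S :=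
      hC.isJordanScheme.isJConfiguration.isRainbow.transpose ▸ Set.mem_image_of_mem _ ⟨a, rfl⟩
    obtain ⟨b, hb⟩ := this
    refine ⟨b, fun x => ?_⟩
    have hx : (a * x, x) ∈ (leftMulRel a).inv := mem_leftMulRel.2 rfl
    rw [← hb] at hx
    exact (mem_leftMulRel.1 hx).symm

end LeftMultiplications

/-! ### The loop of a based scheme. -/

section BasedLoops

variable {Ω : Type u} {C : Set (SetRel Ω Ω)}

theorem IsRainbow.mem_basic (hC : IsRainbow C) (α β : Ω) :
    (α, β) ∈ (hC.basic α β : SetRel Ω Ω) :=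
  (hC.isPartition.2 (α, β)).choose_spec.1.2

variable {F : Type w} [Field F] [Fintype Ω]
variable (hC : IsRegularThinJordanScheme F C)

theorem IsRegularThinJordanScheme.mem_iff (s : C) {ω β : Ω} :
    (ω, β) ∈ (s : SetRel Ω Ω) ↔ β = hC.val s ω :=
  ⟨fun h => (hC.existsUnique s ω).unique h (hC.existsUnique s ω).choose_spec.1,
    fun h => h ▸ (hC.existsUnique s ω).choose_spec.1⟩

namespace BasedLoop

variable {hC} {ω₀ : Ω}

theorem rel_eq_graphRel (a : BasedLoop hC ω₀) : a.rel = graphRel (hC.val a) := by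
  ext ⟨x, y⟩
  exact hC.mem_iff a

theorem graphRel_mem (a : BasedLoop hC ω₀) : graphRel (hC.val a) ∈ C :=
  rel_eq_graphRel a ▸ a.2

theorem toPoint_basic (β : Ω) :
    toPoint (hC := hC) (ω₀ := ω₀)
      (hC.isThinJordanScheme.isJordanScheme.isJConfiguration.isRainbow.basic ω₀ β) = β :=
  ((hC.mem_iff _).1 (IsRainbow.mem_basic _ ω₀ β)).symm

/-- Distinct basic relations are disjoint, so agreement at a single point suffices. -/
theorem val_eq_of_val_eq {a b : BasedLoop hC ω₀} {ω : Ω} (h : hC.val a ω = hC.val b ω) :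
    a = b :=
  Subtype.ext ((hC.isThinJordanScheme.isJordanScheme.isJConfiguration.isRainbow.isPartition.2
    (ω, hC.val a ω)).unique ⟨a.2, (hC.mem_iff a).2 rfl⟩ ⟨b.2, (hC.mem_iff b).2 h⟩)

theorem toPoint_bijective : Function.Bijective (toPoint : BasedLoop hC ω₀ → Ω) :=
  ⟨fun _ _ h => val_eq_of_val_eq h, fun β => ⟨_, toPoint_basic β⟩⟩

theorem toPoint_mul (a b : BasedLoop hC ω₀) : (a * b).toPoint = hC.val a b.toPoint :=
  toPoint_basic _

theorem exists_val_val_eq (a : BasedLoop hC ω₀) :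
    ∃ b : BasedLoop hC ω₀, ∀ ω, hC.val b (hC.val a ω) = ω := by
  have h : a.rel.inv ∈ C := by
    have := Set.mem_image_of_mem SetRel.inv a.2
    rwa [hC.isThinJordanScheme.isJordanScheme.isJConfiguration.isRainbow.transpose] at this
  exact ⟨⟨_, h⟩, fun ω => ((hC.mem_iff ⟨_, h⟩).1
    (show (ω, hC.val a ω) ∈ a.rel from (hC.mem_iff a).2 rfl)).symm⟩

theorem val_bijective (a : BasedLoop hC ω₀) : Function.Bijective (hC.val a) := by
  obtain ⟨b, hb⟩ := exists_val_val_eq a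
  exact Finite.injective_iff_bijective.1 (Function.LeftInverse.injective hb)

variable (hC ω₀)

theorem isLoop : IsLoop (BasedLoop hC ω₀) where
  exists_one := by
    let e : BasedLoop hC ω₀ := 
      (⟨SetRel.id, hC.isThinJordanScheme.isJordanScheme.homogeneous⟩ : C)
    have he : ∀ ω, hC.val e ω = ω := fun ω =>
      ((hC.mem_iff e).1 (show (ω, ω) ∈ (SetRel.id : SetRel Ω Ω) from rfl)).symm
    refine ⟨e, fun x => ⟨toPoint_bijective.1 ?_, toPoint_bijective.1 ?_⟩⟩
    · rw [toPoint_mul, he]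
    · rw [toPoint_mul, show e.toPoint = ω₀ from he ω₀]
      rfl
  left_div a b := by
    obtain ⟨x, hx, hx'⟩ :=
      ((val_bijective a).comp (toPoint_bijective (hC := hC) (ω₀ := ω₀))).existsUnique b.toPoint
    exact ⟨x, toPoint_bijective.1 ((toPoint_mul a x).trans hx),
      fun y hy => hx' y ((toPoint_mul a y).symm.trans (by rw [hy]))⟩
  right_div a b := by
    let r := hC.isThinJordanScheme.isJordanScheme.isJConfiguration.isRainbow
    -- The quotient is the basic relation carrying the point of `a` to the point of `b`.
    let x : BasedLoop hC ω₀ := r.basic a.toPoint b.toPoint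
    have hx : hC.val x a.toPoint = b.toPoint :=
      ((hC.mem_iff _).1 (r.mem_basic a.toPoint b.toPoint)).symm
    refine ⟨x, toPoint_bijective.1 ((toPoint_mul x a).trans hx), fun y hy => ?_⟩
    apply val_eq_of_val_eq (ω := a.toPoint)
    rw [← toPoint_mul, hx]
    exact congrArg toPoint hy

theorem isRALoop (hF : (2 : F) ≠ 0) : IsRALoop.{u, v} (BasedLoop hC ω₀) := by
  classical
  refine (isRALoop_iff (isLoop hC ω₀)).2 ⟨fun g h k => ?_, fun a => ?_⟩
  · refine (pair_eq_pair_of_indicator hF (p := g * (h * k)) (q := h * (g * k)) (r := g * h * k)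
      (s := h * g * k) (fun t => ?_)).imp (And.imp Eq.symm Eq.symm)
      (fun h' => ⟨h'.2.symm, h'.1.symm⟩)
    obtain ⟨c, rfl, -⟩ := (isLoop hC ω₀).right_div k t
    have := hC.isThinJordanScheme.isJordanScheme.indicator_eq hF (graphRel_mem g)
      (graphRel_mem h) (graphRel_mem c) k.toPoint ω₀
    have hk : ∀ x : BasedLoop hC ω₀, x * k = c * k ↔ x = c := fun x =>
      ⟨fun hx => ((isLoop hC ω₀).right_div k (c * k)).unique hx rfl, fun hx => by rw [hx]⟩
    have h0 : ∀ x : BasedLoop hC ω₀, hC.val x ω₀ = x.toPoint := fun _ => rfl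
    simpa only [h0, ← toPoint_mul, toPoint_bijective.1.eq_iff, hk] using this
  · obtain ⟨b, hb⟩ := exists_val_val_eq a
    exact ⟨b, fun x => toPoint_bijective.1 (by rw [toPoint_mul, toPoint_mul, hb])⟩

variable {hC ω₀}

theorem mapRel_toPoint (a : BasedLoop hC ω₀) : mapRel toPoint (leftMulRel a) = a.rel := by
  rw [rel_eq_graphRel, leftMulRel_eq_graphRel]
  exact mapRel_graphRel toPoint_bijective fun x => toPoint_mul a x

theorem isRainbowIso_toPoint :
    IsRainbowIso (toPoint : BasedLoop hC ω₀ → Ω) (leftMulRels (BasedLoop hC ω₀)) C := by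
  refine ⟨toPoint_bijective, ?_⟩
  ext s
  constructor
  · rintro ⟨_, ⟨a, rfl⟩, rfl⟩
    rw [mapRel_toPoint]
    exact a.2
  · exact fun hs => ⟨_, ⟨(⟨s, hs⟩ : C), rfl⟩, mapRel_toPoint (⟨s, hs⟩ : C)⟩

end BasedLoop

theorem IsLoop.exists_mulEquiv_basedLoop {S : Type u} [Fintype S] [Mul S] (hS : IsLoop S)
    (hC : IsRegularThinJordanScheme F (leftMulRels S)) {e : S}
    (he : ∀ x : S, e * x = x ∧ x * e = x) :
    ∃ φ : S ≃* BasedLoop hC e, ∀ a : S, (φ a).rel = leftMulRel a := by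
  let φ : S → BasedLoop hC e := fun a => (⟨leftMulRel a, a, rfl⟩ : leftMulRels S)
  have hval : ∀ a x, hC.val (φ a) x = a * x := fun a x =>
    ((hC.mem_iff (φ a)).1 (mem_leftMulRel.2 rfl)).symm
  have hφ : Function.Bijective φ :=
    ⟨fun a b h => hS.leftMulRel_injective (congrArg Subtype.val h), by
      rintro ⟨_, a, rfl⟩
      exact ⟨a, rfl⟩⟩
  refine ⟨MulEquiv.mk (Equiv.ofBijective φ hφ) fun a b => ?_, fun a => rfl⟩
  apply BasedLoop.toPoint_bijective.1
  have h0 : ∀ a, (φ a).toPoint = a := fun a => (hval a e).trans (he a).2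
  change (φ (a * b)).toPoint = (φ a * φ b).toPoint
  rw [BasedLoop.toPoint_mul, h0, h0, hval]

end BasedLoops

/-! ### Loop isomorphisms versus scheme isomorphisms. -/

section Isomorphisms

variable {S T : Type u} [Mul S] [Mul T]

theorem MulEquiv.isRainbowIso (φ : S ≃* T) :
    IsRainbowIso φ (leftMulRels S) (leftMulRels T) := by
  have h : ∀ a, mapRel φ (leftMulRel a) = leftMulRel (φ a) := fun a =>
    mapRel_graphRel φ.bijective fun x => map_mul φ a x
  refine ⟨φ.bijective, ?_⟩
  ext s
  constructor
  · rintro ⟨_, ⟨a, rfl⟩, rfl⟩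
    exact ⟨φ a, (h a).symm⟩
  · rintro ⟨b, rfl⟩
    exact ⟨_, ⟨φ.symm b, rfl⟩, by rw [h, φ.apply_symm_apply]⟩

theorem IsRainbowIso.nonempty_mulEquiv {f : S → T}
    (hf : IsRainbowIso f (leftMulRels S) (leftMulRels T)) (hS : IsRALoop.{u, v} S)
    (hT : IsRALoop.{u, v} T) : Nonempty (S ≃* T) := by
  have h : ∀ a : S, ∃ b : T, ∀ x, f (a * x) = b * f x := fun a => by
    have : mapRel f (leftMulRel a) ∈ leftMulRels T :=
      hf.2 ▸ Set.mem_image_of_mem _ ⟨a, rfl⟩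
    obtain ⟨b, hb⟩ := this
    refine ⟨b, fun x => ?_⟩
    rw [← mem_leftMulRel, hb]
    exact ⟨(x, a * x), rfl, rfl⟩
  choose π hπ using h
  obtain ⟨JS, rfl⟩ := hS.exists_jordanLoop
  obtain ⟨JT, rfl⟩ := hT.exists_jordanLoop
  exact JordanLoop.nonempty_mulEquiv hf.1 hπ

end Isomorphisms

theorem mainTheorem1 (F : Type w) [Field F] (hF : (2 : F) ≠ 0) :
    -- the left multiplications of a finite loop form a thin Jordan scheme iff it is an RA loop
    (∀ (S : Type u) [Fintype S] [Mul S], IsLoop S →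
      (IsThinJordanScheme F (leftMulRels S) ↔ IsRALoop.{u, v} S)) ∧
    -- every regular thin Jordan scheme with a base point gives an RA loop, whose left
    -- multiplications form a scheme isomorphic to the given one
    (∀ (Ω : Type u) [Fintype Ω] (C : Set (SetRel Ω Ω)) (hC : IsRegularThinJordanScheme F C)
      (ω₀ : Ω),
      IsRALoop.{u, v} (BasedLoop hC ω₀) ∧
      IsRainbowIso (BasedLoop.toPoint : BasedLoop hC ω₀ → Ω) (leftMulRels (BasedLoop hC ω₀)) C ∧
      ∀ a : BasedLoop hC ω₀, mapRel BasedLoop.toPoint (leftMulRel a) = a.rel) ∧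
    -- the scheme of an RA loop is regular and thin, and based at the neutral element it gives
    -- back the loop
    (∀ (S : Type u) [Fintype S] [Mul S], IsRALoop.{u, v} S →
      ∃ hC : IsRegularThinJordanScheme F (leftMulRels S),
        ∀ e : S, (∀ x : S, e * x = x ∧ x * e = x) →
          ∃ φ : S ≃* BasedLoop hC e, ∀ a : S, (φ a).rel = leftMulRel a) ∧
    -- RA loops are isomorphic iff their schemes are
    (∀ (S T : Type u) [Fintype S] [Mul S] [Fintype T] [Mul T],
      IsRALoop.{u, v} S → IsRALoop.{u, v} T →
      (Nonempty (S ≃* T) ↔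
        ∃ f : S → T, IsRainbowIso f (leftMulRels S) (leftMulRels T))) :=
  ⟨fun _ _ _ hS => ⟨fun h => h.isRALoop hF hS,
      fun h => (h.isRegularThinJordanScheme F).isThinJordanScheme⟩,
    fun _ _ _ hC ω₀ => ⟨BasedLoop.isRALoop hC ω₀ hF, BasedLoop.isRainbowIso_toPoint,
      BasedLoop.mapRel_toPoint⟩,
    fun _ _ _ h => ⟨h.isRegularThinJordanScheme F, fun _ he =>
      h.1.exists_mulEquiv_basedLoop _ he⟩,
    fun _ _ _ _ _ _ hS hT => ⟨fun ⟨φ⟩ => ⟨φ, φ.isRainbowIso⟩,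
      fun ⟨_, hf⟩ => hf.nonempty_mulEquiv hS hT⟩⟩
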